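/- Let $m\ge 1$ and $k\in\mathbb{R}$. A strategy is a pair $\gamma=(\gamma_1,\gamma_2)$ of functions $\mathbb{R}^m\to\mathbb{R}^m$. For an initial state $x_0$ and a noise vector $z$ in $\mathbb{R}^m$ put $u_1=\gamma_1(x_0)$, $x_1=x_0+u_1$, $u_2=\gamma_2(x_1+z)$, $x_2=x_1-u_2$ and $$J^{(\gamma)}(x_0,z)=\tfrac1m k^2\|u_1\|^2+\tfrac1m\|x_2\|^2,\qquad J^{(\gamma)}_{freq}=\sup_{x_0\in\mathbb{R}^m,\ |z_i|<\sqrt3\ \forall i}J^{(\gamma)}(x_0,z)\in[0,\infty],$$ where $\|\cdot\|$ is the Euclidean norm. Let $J_{opt,freq}=\inf_\gamma J^{(\gamma)}_{freq}$, let $J_{lin}$ be the infimum of $J^{(\gamma)}_{freq}$ over the strategies with $\gamma_1$ and $\gamma_2$ linear, and let $$L(k)=\inf_{P\ge0}\Big[k^2P+\Big(\big(\sqrt{6/(\pi e)}-\sqrt P\big)^+\Big)^2\Big].$$ Then the following hold. 1. $L(k)\le J_{opt,freq}\le 2\pi e\,L(k)$. 2. The upper bound is achieved by quantization-based strategies complemented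 by linear strategies. Let $Q$ round every coordinate to a nearest point of $2\sqrt3\,\mathbb{Z}$. The quantization strategy $\gamma_1(x)=Q(x)-x$, $\gamma_2(y)=Q(y)$ has worst-case cost $J^{(\gamma)}_{freq}=3k^2$, the (linear) zero-input strategy $\gamma_1(x)=0$, $\gamma_2(y)=y$ has worst-case cost $J^{(\gamma)}_{freq}=3$, and $\min\{3k^2,3\}\le 2\pi e\,L(k)$. 3. As $k\to0$, $k\ne0$, the ratio of $J_{lin}$ to the worst-case cost of this quantization strategy tends to infinity. -/

import Mathlib

open Filter Topology

/-- State, input, observation and noise vectors: `ℝ^m` with the Euclidean norm. -/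
abbrev Vec (m : ℕ) : Type := EuclideanSpace ℝ (Fin m)

/-- A control strategy `γ = (γ₁, γ₂)`: arbitrary functions that map the observation of each
controller to its input. -/
structure Strategy (m : ℕ) where
  γ₁ : Vec m → Vec m
  γ₂ : Vec m → Vec m

namespace Strategy

variable {m : ℕ}

/-- The state `x₁ = x₀ + u₁` after the first stage, where `u₁ = γ₁ x₀`. -/
noncomputable def x₁ (γ : Strategy m) (x₀ : Vec m) : Vec m := x₀ + γ.γ₁ x₀

/-- The final state `x₂ = x₁ - u₂`, where `u₂ = γ₂ (x₁ + z)`. -/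
noncomputable def x₂ (γ : Strategy m) (x₀ z : Vec m) : Vec m :=
  γ.x₁ x₀ - γ.γ₂ (γ.x₁ x₀ + z)

/-- The quadratic cost `J^γ(x₀, z) = k² ‖u₁‖² / m + ‖x₂‖² / m`. -/
noncomputable def cost (k : ℝ) (γ : Strategy m) (x₀ z : Vec m) : ℝ :=
  1 / (m : ℝ) * k ^ 2 * ‖γ.γ₁ x₀‖ ^ 2 + 1 / (m : ℝ) * ‖γ.x₂ x₀ z‖ ^ 2

/-- The worst-case cost: the supremum, possibly infinite, of the cost over all initial states and
all noise vectors with `|z_i| < √3` for all `i`. -/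
noncomputable def worstCost (k : ℝ) (γ : Strategy m) : ENNReal :=
  ⨆ (x₀ : Vec m) (z : Vec m) (_ : ∀ i, |z i| < √3), ENNReal.ofReal (γ.cost k x₀ z)

/-- Both controllers are linear maps. -/
def IsLinear (γ : Strategy m) : Prop :=
  IsLinearMap ℝ γ.γ₁ ∧ IsLinearMap ℝ γ.γ₂

end Strategy

/-- The optimal worst-case cost over all strategies. -/
noncomputable def optCost (m : ℕ) (k : ℝ) : ENNReal :=
  ⨅ γ : Strategy m, γ.worstCost k

/-- The optimal worst-case cost over linear strategies. -/
noncomputable def linCost (m : ℕ) (k : ℝ) : ENNReal :=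
  ⨅ (γ : Strategy m) (_ : γ.IsLinear), γ.worstCost k

/-- Uniform scalar quantization of every coordinate with bins of size `2√3`. -/
noncomputable def quantize {m : ℕ} (x : Vec m) : Vec m :=
  WithLp.toLp 2 fun i => 2 * √3 * (round (x i / (2 * √3)) : ℝ)

/-- The quantization strategy: the first controller moves the state to the nearest quantization
point, and the second controller decodes its observation to the nearest quantization point. -/
noncomputable def quantStrategy (m : ℕ) : Strategy m where
  γ₁ := fun x => quantize x - x
  γ₂ := fun y => quantize y

/-- The zero-input strategy: the first controller does nothing, and the second controller uses its
observation as the estimate of the state. -/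
noncomputable def zeroInputStrategy (m : ℕ) : Strategy m where
  γ₁ := fun _ => 0
  γ₂ := fun y => y

/-- `inf_{P ≥ 0} k² P + ((√(6 / (π e)) - √P)⁺)²`. -/
noncomputable def lowerCost (k : ℝ) : ℝ :=
  ⨅ P : NNReal, (k ^ 2 * (P : ℝ) +
    (max (√(6 / (Real.pi * Real.exp 1)) - √(P : ℝ)) 0) ^ 2)

/-! The lower bound is sphere covering. If `‖u₁‖ + ‖x₂‖ ≤ r` always, then `x₀ - γ₂ y = x₂ - u₁`
confines every initial state compatible with an observation `y` to a ball of radius `r`. Each state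
can produce a full noise cube of observations, so double counting makes the ball at least as large
as the cube. States are sampled on a finite grid, hence `γ` need not be measurable. The bound on
ball volume turns this into `p + d ≥ √(6/(πe))`, up to any `ε`, for the normalized norms of `u₁` and
`x₂`; this yields `lowerCost`. The upper bound compares `L(k)` with the two explicit strategies. A
linear strategy of finite cost must be the zero-input one when `k ≠ 0`, so the ratio to quantization
is at least `1/k²`. -/

/-! ### Volume of Euclidean balls -/

/-- Keep only the part `t > x` of the Gamma integral, where `t ^ x ≥ x ^ x`. At `x = m/2` this is
the source of the constant `2πe`. -/
theorem Real.rpow_mul_exp_neg_le_Gamma_add_one {x : ℝ} (hx : 0 < x) :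
    x ^ x * Real.exp (-x) ≤ Real.Gamma (x + 1) := by
  rw [Real.Gamma_eq_integral (by positivity), add_sub_cancel_right]
  have hint : MeasureTheory.IntegrableOn (fun t : ℝ => Real.exp (-t) * t ^ x) (Set.Ioi 0) := by
    simpa using Real.GammaIntegral_convergent (s := x + 1) (by positivity)
  have hsub : Set.Ioi x ⊆ Set.Ioi 0 := Set.Ioi_subset_Ioi hx.le
  calc x ^ x * Real.exp (-x) = ∫ t in Set.Ioi x, Real.exp (-t) * x ^ x := by
        rw [MeasureTheory.integral_mul_const, integral_exp_neg_Ioi, mul_comm]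
    _ ≤ ∫ t in Set.Ioi x, Real.exp (-t) * t ^ x := by
        refine MeasureTheory.setIntegral_mono_on
          ((integrableOn_exp_neg_Ioi x).mul_const _) (hint.mono_set hsub)
          measurableSet_Ioi fun t ht => ?_
        have : x ≤ t := le_of_lt ht
        gcongr
    _ ≤ ∫ t in Set.Ioi 0, Real.exp (-t) * t ^ x := by
        refine MeasureTheory.setIntegral_mono_set hint ?_ hsub.eventuallyLE
        filter_upwards [MeasureTheory.ae_restrict_mem measurableSet_Ioi] with t ht
        have : (0 : ℝ) < t := ht
        positivity

/-- Upper bound `(R √(2πe/m))^m` for the volume of a Euclidean ball of radius `R`. -/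
theorem volume_closedBall_le {m : ℕ} (hm : 0 < m) (c : Vec m) {R : ℝ} (hR : 0 ≤ R) :
    MeasureTheory.volume (Metric.closedBall c R) ≤
      ENNReal.ofReal ((R * √(2 * Real.pi * Real.exp 1 / m)) ^ m) := by
  have : Nonempty (Fin m) := ⟨⟨0, hm⟩⟩
  have hm' : (0 : ℝ) < m := by exact_mod_cast hm
  rw [EuclideanSpace.volume_closedBall, Fintype.card_fin, ← ENNReal.ofReal_pow hR,
    ← ENNReal.ofReal_mul (by positivity), mul_pow]
  refine ENNReal.ofReal_le_ofReal (mul_le_mul_of_nonneg_left ?_ (by positivity))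
  have key := Real.rpow_mul_exp_neg_le_Gamma_add_one (x := (m : ℝ) / 2) (by positivity)
  have hsq : ((m : ℝ) / 2) ^ ((m : ℝ) / 2) * Real.exp (-((m : ℝ) / 2))
      = (√((m : ℝ) / 2 * Real.exp (-1))) ^ m := by
    rw [← Real.rpow_natCast, Real.sqrt_eq_rpow, ← Real.rpow_mul (by positivity),
      Real.mul_rpow (by positivity) (by positivity), ← Real.exp_mul]
    congr 2 <;> ring_nf
  rw [hsq] at key
  rw [div_le_iff₀ (by apply Real.Gamma_pos_of_pos; positivity)]
  calc √Real.pi ^ m = √(2 * Real.pi * Real.exp 1 / m) ^ m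
        * (√((m : ℝ) / 2 * Real.exp (-1))) ^ m := by
        rw [← mul_pow, ← Real.sqrt_mul (by positivity), Real.exp_neg]
        congr 2
        field_simp
    _ ≤ _ := by gcongr

/-! ### Boxes and grids -/

/-- The open box with lower corner `a` and upper corner `b`. -/
def openBox {m : ℕ} (a b : Fin m → ℝ) : Set (Vec m) :=
  {x | ∀ i, a i < x i ∧ x i < b i}

theorem openBox_eq_preimage {m : ℕ} (a b : Fin m → ℝ) :
    openBox a b = (WithLp.ofLp (p := 2) (V := Fin m → ℝ)) ⁻¹'
      (Set.univ.pi fun i => Set.Ioo (a i) (b i)) := by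
  ext x
  simp [openBox]

theorem measurableSet_openBox {m : ℕ} (a b : Fin m → ℝ) : MeasurableSet (openBox a b) := by
  rw [openBox_eq_preimage]
  exact (PiLp.volume_preserving_ofLp (Fin m)).measurable
    (MeasurableSet.univ_pi fun i => measurableSet_Ioo)

theorem volume_openBox {m : ℕ} (a b : Fin m → ℝ) :
    MeasureTheory.volume (openBox a b) = ∏ i, ENNReal.ofReal (b i - a i) := by
  rw [openBox_eq_preimage, (PiLp.volume_preserving_ofLp (Fin m)).measure_preimage
    (MeasurableSet.univ_pi fun i => measurableSet_Ioo).nullMeasurableSet, Real.volume_pi_Ioo]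

theorem volume_openBox_of_const {m : ℕ} {a b : Fin m → ℝ} {l : ℝ} (hl : 0 ≤ l)
    (h : ∀ i, b i - a i = l) :
    MeasureTheory.volume (openBox a b) = ENNReal.ofReal (l ^ m) := by
  simp [volume_openBox, h, ENNReal.ofReal_pow hl]

theorem abs_apply_le_norm {m : ℕ} (x : Vec m) (i : Fin m) : |x i| ≤ ‖x‖ := by
  simpa using PiLp.norm_apply_le x i

theorem norm_le_sqrt_mul {m : ℕ} {x : Vec m} {d : ℝ} (hd : 0 ≤ d) (h : ∀ i, |x i| ≤ d) :
    ‖x‖ ≤ √m * d := by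
  rw [EuclideanSpace.norm_eq]
  apply Real.sqrt_le_iff.2 ⟨by positivity, ?_⟩
  rw [mul_pow, Real.sq_sqrt (by positivity)]
  calc ∑ i, ‖x i‖ ^ 2 ≤ ∑ _i : Fin m, d ^ 2 :=
        Finset.sum_le_sum fun i _ => by gcongr; exact h i
    _ = m * d ^ 2 := by simp

/-- The point `d • v` of the grid with spacing `d`. -/
noncomputable def gridPoint {m n : ℕ} (d : ℝ) (v : Fin m → Fin n) : Vec m :=
  WithLp.toLp 2 fun i => d * (v i : ℝ)

/-- The open grid cell with lower corner `d • v`. -/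
noncomputable def gridCell {m n : ℕ} (d : ℝ) (v : Fin m → Fin n) : Set (Vec m) :=
  openBox (fun i => d * (v i : ℝ)) (fun i => d * (v i : ℝ) + d)

theorem pairwise_disjoint_gridCell {m n : ℕ} {d : ℝ} (hd : 0 < d) :
    Pairwise (Function.onFun Disjoint (gridCell (m := m) (n := n) d)) := by
  intro v w hvw
  refine Set.disjoint_left.2 fun x hv hw => hvw ?_
  funext i
  obtain ⟨h1, h2⟩ := hv i
  obtain ⟨h3, h4⟩ := hw i
  have h5 : (v i : ℝ) < (w i : ℝ) + 1 := by
    have : d * (v i : ℝ) < d * ((w i : ℝ) + 1) := by linarith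
    exact lt_of_mul_lt_mul_left this hd.le
  have h6 : (w i : ℝ) < (v i : ℝ) + 1 := by
    have : d * (w i : ℝ) < d * ((v i : ℝ) + 1) := by linarith
    exact lt_of_mul_lt_mul_left this hd.le
  norm_cast at h5 h6
  exact Fin.ext (by omega)

/-- The cells at these points are disjoint and have diameter at most `√m * d`, so they pack into the
ball enlarged by that amount. -/
theorem card_gridPoints_mul_le {m n : ℕ} (hm : 0 < m) {d r : ℝ} (hd : 0 < d) (hr : 0 ≤ r)
    (c : Vec m) (S : Finset (Fin m → Fin n)) (hS : ∀ v ∈ S, ‖gridPoint d v - c‖ ≤ r) :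
    (S.card : ℝ) * d ^ m ≤ ((r + √m * d) * √(2 * Real.pi * Real.exp 1 / m)) ^ m := by
  have hsub : (⋃ v ∈ S, gridCell d v) ⊆ Metric.closedBall c (r + √m * d) := by
    refine Set.iUnion₂_subset fun v hv x hx => ?_
    rw [Metric.mem_closedBall, dist_eq_norm]
    have h1 : ‖x - gridPoint d v‖ ≤ √m * d := by
      refine norm_le_sqrt_mul hd.le fun i => ?_
      obtain ⟨h1, h2⟩ := hx i
      have : (x - gridPoint d v) i = x i - d * (v i : ℝ) := by simp [gridPoint]
      rw [this, abs_le]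
      constructor <;> linarith
    calc ‖x - c‖ = ‖(x - gridPoint d v) + (gridPoint d v - c)‖ := by congr 1; abel
      _ ≤ √m * d + r := (norm_add_le _ _).trans (add_le_add h1 (hS v hv))
      _ = r + √m * d := add_comm _ _
  have h := (MeasureTheory.measure_mono hsub).trans
    (volume_closedBall_le hm c (R := r + √m * d) (by positivity))
  rw [MeasureTheory.measure_biUnion_finset
    (fun v _ w _ hvw => pairwise_disjoint_gridCell hd hvw)
    (fun v _ => measurableSet_openBox _ _)] at h
  have hcell (v : Fin m → Fin n) :
      MeasureTheory.volume (gridCell d v) = ENNReal.ofReal (d ^ m) :=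
    volume_openBox_of_const hd.le fun i => by ring
  simp only [hcell, Finset.sum_const, nsmul_eq_mul] at h
  rw [← ENNReal.ofReal_natCast, ← ENNReal.ofReal_mul (by positivity)] at h
  exact (ENNReal.ofReal_le_ofReal_iff (by positivity)).1 h

/-! ### The covering argument -/

/-- Double counting: sets inside `T` that cover every point at most `K` times have total measure
at most `K * μ T`. -/
theorem sum_measure_le_of_multiplicity_le {α ι : Type*} [MeasurableSpace α]
    (μ : MeasureTheory.Measure α) [Fintype ι] {s : ι → Set α} {T : Set α} {K : ENNReal}
    (hs : ∀ i, MeasurableSet (s i)) (hT : MeasurableSet T) (hsT : ∀ i, s i ⊆ T)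
    (hK : ∀ y, ∀ S : Finset ι, (∀ i ∈ S, y ∈ s i) → (S.card : ENNReal) ≤ K) :
    ∑ i, μ (s i) ≤ K * μ T := by
  classical
  calc ∑ i, μ (s i) = ∑ i, ∫⁻ y, (s i).indicator 1 y ∂μ := by
        simp [hs]
    _ = ∫⁻ y, ∑ i, (s i).indicator 1 y ∂μ := by
        rw [MeasureTheory.lintegral_finsetSum]
        exact fun i _ => measurable_one.indicator (hs i)
    _ ≤ ∫⁻ y, T.indicator (fun _ => K) y ∂μ := by
        refine MeasureTheory.lintegral_mono fun y => ?_
        by_cases hy : y ∈ T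
        · rw [Set.indicator_of_mem hy]
          refine le_trans (le_of_eq ?_) (hK y (Finset.univ.filter fun i => y ∈ s i) (by simp))
          simp [Set.indicator_apply]
        · rw [Set.indicator_of_notMem hy]
          simp only [nonpos_iff_eq_zero, Finset.sum_eq_zero_iff, Finset.mem_univ, true_implies]
          exact fun i => Set.indicator_of_notMem (fun h => hy (hsT i h)) _
    _ = K * μ T := MeasureTheory.lintegral_indicator_const hT K
/-- If the sum of the input norm and the final state norm never exceeds `r`, then a ball of radius
`r` is at least as voluminous as the noise cube. -/
theorem Strategy.two_sqrt_three_le_of_forall_norm_add_le {m : ℕ} (hm : 0 < m) (γ : Strategy m)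
    {r : ℝ} (h : ∀ x₀ z : Vec m, (∀ i, |z i| < √3) → ‖γ.γ₁ x₀‖ + ‖γ.x₂ x₀ z‖ ≤ r) :
    2 * √3 ≤ r * √(2 * Real.pi * Real.exp 1 / m) := by
  set κ := √(2 * Real.pi * Real.exp 1 / m) with hκ
  have hκ0 : 0 ≤ κ := Real.sqrt_nonneg _
  have hr : 0 ≤ r := le_trans (by positivity) (h 0 0 (by simp))
  have hgrid : ∀ d : ℝ, 0 < d → ∀ n : ℕ,
      2 * √3 * d * n ≤ (d * n + 2 * (r + √3)) * ((r + √m * d) * κ) := by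
    intro d hd n
    -- `s v` is the set of observations that the initial state `gridPoint d v` can produce; `T`
    -- contains them all because inputs move each coordinate by at most `r`.
    let s : (Fin m → Fin n) → Set (Vec m) := fun v =>
      openBox (fun i => γ.x₁ (gridPoint d v) i - √3) (fun i => γ.x₁ (gridPoint d v) i + √3)
    let T : Set (Vec m) := openBox (fun _ => -(r + √3)) (fun _ => d * n + (r + √3))
    have hu : ∀ x, ‖γ.γ₁ x‖ ≤ r := fun x =>
      le_trans (le_add_of_nonneg_right (norm_nonneg _)) (h x 0 (by simp))
    have hsT : ∀ v, s v ⊆ T := by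
      intro v y hy i
      obtain ⟨h1, h2⟩ := hy i
      have h3 := abs_le.1 ((abs_apply_le_norm (γ.γ₁ (gridPoint d v)) i).trans (hu _))
      have h4 : γ.x₁ (gridPoint d v) i = d * (v i : ℝ) + γ.γ₁ (gridPoint d v) i := by
        simp [Strategy.x₁, gridPoint]
      have h5 : (v i : ℝ) ≤ n := by exact_mod_cast (v i).2.le
      have h6 : d * (v i : ℝ) ≤ d * n := by gcongr
      have h7 : 0 ≤ d * (v i : ℝ) := by positivity
      simp only [h4] at h1 h2
      constructor <;> linarith [h3.1, h3.2]
    have hK : ∀ y, ∀ S : Finset (Fin m → Fin n), (∀ v ∈ S, y ∈ s v) →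
        (S.card : ENNReal) ≤ ENNReal.ofReal (((r + √m * d) * κ) ^ m / d ^ m) := by
      intro y S hS
      rw [← ENNReal.ofReal_natCast]
      refine ENNReal.ofReal_le_ofReal ((le_div_iff₀ (by positivity)).2 ?_)
      refine card_gridPoints_mul_le hm hd hr (γ.γ₂ y) S fun v hv => ?_
      have hz := h (gridPoint d v) (y - γ.x₁ (gridPoint d v)) fun i => by
        obtain ⟨h1, h2⟩ := hS v hv i
        rw [PiLp.sub_apply, abs_lt]
        constructor <;> linarith
      have h1 : gridPoint d v - γ.γ₂ y
          = γ.x₂ (gridPoint d v) (y - γ.x₁ (gridPoint d v)) - γ.γ₁ (gridPoint d v) := by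
        simp only [Strategy.x₂, add_sub_cancel]
        simp only [Strategy.x₁]
        abel
      rw [h1]
      exact (norm_sub_le _ _).trans (by linarith)
    have hmain := sum_measure_le_of_multiplicity_le MeasureTheory.volume (s := s) (T := T)
      (fun v => measurableSet_openBox _ _) (measurableSet_openBox _ _) hsT hK
    have hvs (v : Fin m → Fin n) :
        MeasureTheory.volume (s v) = ENNReal.ofReal ((2 * √3) ^ m) :=
      volume_openBox_of_const (by positivity) fun i => by ring
    have hvT : MeasureTheory.volume T = ENNReal.ofReal ((d * n + 2 * (r + √3)) ^ m) :=
      volume_openBox_of_const (by positivity) fun i => by ring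
    simp only [hvs, hvT, Finset.sum_const, Finset.card_univ, Fintype.card_fun, Fintype.card_fin,
      nsmul_eq_mul] at hmain
    rw [← ENNReal.ofReal_natCast, ← ENNReal.ofReal_mul (by positivity),
      ← ENNReal.ofReal_mul (by positivity),
      ENNReal.ofReal_le_ofReal_iff (by positivity), div_mul_eq_mul_div,
      le_div_iff₀ (by positivity)] at hmain
    refine le_of_pow_le_pow_left₀ hm.ne' (by positivity) ?_
    calc (2 * √3 * d * n) ^ m = ((n ^ m : ℕ) : ℝ) * (2 * √3) ^ m * d ^ m := by
          push_cast; ring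
      _ ≤ _ := hmain
      _ = _ := by rw [← mul_pow, mul_comm]
  -- Boundary effects vanish as `n → ∞` with `d` fixed; the mesh `d` then tends to `0`.
  have hlim : ∀ d : ℝ, 0 < d → 2 * √3 ≤ (r + √m * d) * κ := by
    intro d hd
    by_contra! hlt
    obtain ⟨n, hn⟩ := exists_nat_gt
      (2 * (r + √3) * ((r + √m * d) * κ) / (d * (2 * √3 - (r + √m * d) * κ)))
    rw [div_lt_iff₀ (mul_pos hd (sub_pos.2 hlt))] at hn
    linarith [hgrid d hd n]
  have htend : Tendsto (fun d : ℝ => (r + √m * d) * κ) (𝓝[>] 0) (𝓝 ((r + √m * 0) * κ)) :=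
    (Continuous.tendsto (by fun_prop) 0).mono_left nhdsWithin_le_nhds
  have := ge_of_tendsto htend (eventually_mem_nhdsWithin.mono fun d hd => hlim d hd)
  simpa using this

/-! ### The function `L(k)` -/

theorem lowerCost_le (k : ℝ) {P : ℝ} (hP : 0 ≤ P) :
    lowerCost k ≤ k ^ 2 * P + (max (√(6 / (Real.pi * Real.exp 1)) - √P) 0) ^ 2 :=
  ciInf_le (f := fun P : NNReal => k ^ 2 * (P : ℝ) +
    (max (√(6 / (Real.pi * Real.exp 1)) - √(P : ℝ)) 0) ^ 2)
    ⟨0, by rintro _ ⟨P, rfl⟩; positivity⟩ ⟨P, hP⟩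

theorem le_lowerCost {k c : ℝ} (h : ∀ P : ℝ, 0 ≤ P →
    c ≤ k ^ 2 * P + (max (√(6 / (Real.pi * Real.exp 1)) - √P) 0) ^ 2) : c ≤ lowerCost k :=
  le_ciInf fun P => h P P.2

/-- With `a = √(6/(πe))` one has `2πe (a/2)² = 3`. Either `√P ≥ a/2` and the input term suffices, or
`a - √P ≥ a/2` and the final term does. -/
theorem min_le_mul_lowerCost (k : ℝ) :
    min (3 * k ^ 2) 3 ≤ 2 * Real.pi * Real.exp 1 * lowerCost k := by
  have hpe : 0 < 2 * Real.pi * Real.exp 1 := by positivity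
  rw [← div_le_iff₀' hpe]
  refine le_lowerCost fun P hP => ?_
  set a := √(6 / (Real.pi * Real.exp 1)) with ha
  have ha0 : 0 ≤ a := Real.sqrt_nonneg _
  have ha2 : a ^ 2 = 6 / (Real.pi * Real.exp 1) := Real.sq_sqrt (by positivity)
  have hmin : min (3 * k ^ 2) 3 / (2 * Real.pi * Real.exp 1) = min (k ^ 2) 1 * (a / 2) ^ 2 := by
    rw [div_pow, ha2, show min (3 * k ^ 2) 3 = 3 * min (k ^ 2) 1 by
      rw [mul_min_of_nonneg _ _ (by norm_num : (0 : ℝ) ≤ 3), mul_one]]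
    ring
  rw [hmin]
  rcases le_total (a / 2) √P with h | h
  · have hP2 : (a / 2) ^ 2 ≤ P := by
      rw [← Real.sq_sqrt hP]; gcongr
    calc min (k ^ 2) 1 * (a / 2) ^ 2 ≤ k ^ 2 * P := by
          gcongr; exact min_le_left _ _
      _ ≤ _ := le_add_of_nonneg_right (by positivity)
  · have h1 : a / 2 ≤ max (a - √P) 0 := le_max_of_le_left (by linarith)
    calc min (k ^ 2) 1 * (a / 2) ^ 2 ≤ 1 * (max (a - √P) 0) ^ 2 := by
          gcongr; exact min_le_right _ _
      _ ≤ _ := by rw [one_mul]; exact le_add_of_nonneg_left (by positivity)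

/-! ### Lower bound for all strategies, and rigidity of linear ones -/

namespace Strategy

variable {m : ℕ} {γ : Strategy m} {k : ℝ}

theorem ofReal_cost_le_worstCost (k : ℝ) (γ : Strategy m) (x₀ : Vec m) {z : Vec m}
    (hz : ∀ i, |z i| < √3) : ENNReal.ofReal (γ.cost k x₀ z) ≤ γ.worstCost k :=
  le_iSup_of_le x₀ (le_iSup₂_of_le z hz le_rfl)

theorem worstCost_le {c : ENNReal}
    (h : ∀ x₀ z : Vec m, (∀ i, |z i| < √3) → ENNReal.ofReal (γ.cost k x₀ z) ≤ c) :
    γ.worstCost k ≤ c :=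
  iSup_le fun x₀ => iSup₂_le fun z hz => h x₀ z hz

theorem lowerCost_le_of_cost_le (hm : 0 < m) {w : ℝ}
    (h : ∀ x₀ z : Vec m, (∀ i, |z i| < √3) → γ.cost k x₀ z ≤ w) : lowerCost k ≤ w := by
  set a := √(6 / (Real.pi * Real.exp 1)) with ha
  have ha0 : 0 < a := Real.sqrt_pos.2 (by positivity)
  have hm' : (0 : ℝ) < m := by exact_mod_cast hm
  by_contra! hlt
  -- Replacing `a` by `a - ε` changes the square `((a - p)⁺)²` by at most `2aε`.
  obtain ⟨ε, hε, hεw⟩ : ∃ ε : ℝ, 0 < ε ∧ 2 * a * ε < lowerCost k - w :=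
    ⟨(lowerCost k - w) / (4 * a), div_pos (sub_pos.2 hlt) (by positivity), by
      rw [mul_div_assoc', div_lt_iff₀ (by positivity)]; nlinarith [mul_pos ha0 (sub_pos.2 hlt)]⟩
  obtain ⟨x₀, z, hz, hbig⟩ : ∃ x₀ z : Vec m, (∀ i, |z i| < √3) ∧
      √m * (a - ε) < ‖γ.γ₁ x₀‖ + ‖γ.x₂ x₀ z‖ := by
    by_contra! hsmall
    have h1 := γ.two_sqrt_three_le_of_forall_norm_add_le hm hsmall
    have h2 : √m * √(2 * Real.pi * Real.exp 1 / m) = √(2 * Real.pi * Real.exp 1) := by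
      rw [← Real.sqrt_mul hm'.le]; congr 1; field_simp
    have h3 : a * √(2 * Real.pi * Real.exp 1) = 2 * √3 := by
      rw [ha, ← Real.sqrt_mul (by positivity),
        show (2 : ℝ) = √4 by rw [show (4 : ℝ) = 2 ^ 2 by norm_num]; simp,
        ← Real.sqrt_mul (by norm_num)]
      congr 1
      rw [show (√4 : ℝ) = 2 by rw [show (4 : ℝ) = 2 ^ 2 by norm_num]; simp]
      field_simp
      norm_num
    have h4 : 0 < √(2 * Real.pi * Real.exp 1) := by positivity
    nlinarith [mul_pos hε h4]
  set p := ‖γ.γ₁ x₀‖ / √m with hp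
  set d := ‖γ.x₂ x₀ z‖ / √m with hd
  have hp0 : 0 ≤ p := by positivity
  have hd0 : 0 ≤ d := by positivity
  have hpd : a - ε < p + d := by
    rw [hp, hd, ← add_div, lt_div_iff₀ (by positivity)]; linarith
  have hcost : k ^ 2 * p ^ 2 + d ^ 2 ≤ w := by
    refine le_trans (le_of_eq ?_) (h x₀ z hz)
    rw [hp, hd, div_pow, div_pow, Real.sq_sqrt hm'.le, Strategy.cost]
    ring
  have hL := lowerCost_le k (P := p ^ 2) (by positivity)
  rw [Real.sqrt_sq hp0, ← ha] at hL
  rcases le_total a p with hap | hap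
  · rw [max_eq_right (by linarith)] at hL
    nlinarith [mul_pos ha0 hε]
  · rw [max_eq_left (by linarith)] at hL
    rcases le_total ε (a - p) with h1 | h1
    · have h2 : (a - p - ε) ^ 2 ≤ d ^ 2 := by
        have : 0 ≤ a - p - ε := by linarith
        gcongr
        linarith
      nlinarith [mul_nonneg hp0 hε.le]
    · nlinarith [mul_nonneg hp0 hε.le, mul_pos ha0 hε,
        mul_le_mul_of_nonneg_left h1 (sub_nonneg.2 hap)]

theorem ofReal_lowerCost_le_worstCost (hm : 0 < m) (k : ℝ) (γ : Strategy m) :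
    ENNReal.ofReal (lowerCost k) ≤ γ.worstCost k := by
  by_cases htop : γ.worstCost k = ⊤
  · simp [htop]
  refine ENNReal.ofReal_le_of_le_toReal (lowerCost_le_of_cost_le (γ := γ) hm fun x₀ z hz => ?_)
  exact (ENNReal.ofReal_le_iff_le_toReal htop).1 (ofReal_cost_le_worstCost k γ x₀ hz)

theorem worstCost_eq_top_of_unbounded
    (h : ∀ N : ℝ, ∃ x₀, N ≤ γ.cost k x₀ 0) : γ.worstCost k = ⊤ := by
  refine ENNReal.eq_top_of_forall_nnreal_le fun N => ?_
  obtain ⟨x₀, hx₀⟩ := h N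
  calc (N : ENNReal) = ENNReal.ofReal N := (ENNReal.ofReal_coe_nnreal).symm
    _ ≤ _ := (ENNReal.ofReal_le_ofReal hx₀).trans (ofReal_cost_le_worstCost k γ x₀ (by simp))

theorem IsLinear.cost_smul_zero (hγ : γ.IsLinear) (k t : ℝ) (x : Vec m) :
    γ.cost k (t • x) 0 = t ^ 2 * γ.cost k x 0 := by
  have h1 : γ.γ₁ (t • x) = t • γ.γ₁ x := hγ.1.map_smul t x
  have h2 : γ.x₂ (t • x) 0 = t • γ.x₂ x 0 := by
    simp only [Strategy.x₂, Strategy.x₁, h1, add_zero]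
    rw [← smul_add, hγ.2.map_smul, smul_sub]
  rw [Strategy.cost, Strategy.cost, h1, h2, norm_smul, norm_smul, mul_pow, mul_pow,
    Real.norm_eq_abs, sq_abs]
  ring

theorem cost_nonneg (k : ℝ) (γ : Strategy m) (x₀ z : Vec m) : 0 ≤ γ.cost k x₀ z := by
  unfold Strategy.cost
  positivity

/-- A linear strategy with finite worst-case cost is the zero-input strategy. -/
theorem IsLinear.eq_zeroInputStrategy (hm : 0 < m) (hγ : γ.IsLinear) (hk : k ≠ 0)
    (h : γ.worstCost k ≠ ⊤) : γ = zeroInputStrategy m := by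
  -- Without noise the cost is homogeneous of degree 2 in the state, so one nonzero value makes the
  -- supremum infinite.
  have hzero : ∀ x, γ.cost k x 0 = 0 := by
    intro x
    by_contra hx
    have hpos := (cost_nonneg k γ x 0).lt_of_ne' hx
    refine h (worstCost_eq_top_of_unbounded fun N =>
      ⟨√(|N| / γ.cost k x 0) • x, ?_⟩)
    rw [hγ.cost_smul_zero, Real.sq_sqrt (by positivity), div_mul_cancel₀ _ hpos.ne']
    exact le_abs_self N
  have hm' : (0 : ℝ) < m := by exact_mod_cast hm
  have h1 : ∀ x, γ.γ₁ x = 0 := by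
    intro x
    have h2 := hzero x
    rw [Strategy.cost, add_eq_zero_iff_of_nonneg (by positivity) (by positivity)] at h2
    simpa [hm.ne', hk] using h2.1
  have h2 : ∀ x, γ.γ₂ x = x := by
    intro x
    have h2 := hzero x
    rw [Strategy.cost, add_eq_zero_iff_of_nonneg (by positivity) (by positivity)] at h2
    have h3 : γ.x₂ x 0 = 0 := by simpa [hm.ne'] using h2.2
    simp only [Strategy.x₂, Strategy.x₁, h1, add_zero, sub_eq_zero] at h3
    exact h3.symm
  obtain ⟨γ₁, γ₂⟩ := γ
  simp only [zeroInputStrategy, Strategy.mk.injEq]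
  exact ⟨funext h1, funext h2⟩

end Strategy

/-! ### Costs of the explicit strategies -/

theorem norm_sq_le_mul {m : ℕ} {x : Vec m} {d : ℝ} (hd : 0 ≤ d) (h : ∀ i, |x i| ≤ d) :
    ‖x‖ ^ 2 ≤ m * d ^ 2 := by
  calc ‖x‖ ^ 2 ≤ (√m * d) ^ 2 := by gcongr; exact norm_le_sqrt_mul hd h
    _ = m * d ^ 2 := by rw [mul_pow, Real.sq_sqrt (by positivity)]

theorem norm_sq_toLp_const (m : ℕ) (d : ℝ) :
    ‖(WithLp.toLp 2 fun _ => d : Vec m)‖ ^ 2 = m * d ^ 2 := by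
  simp [EuclideanSpace.real_norm_sq_eq]

theorem zeroInputStrategy_isLinear (m : ℕ) : (zeroInputStrategy m).IsLinear :=
  ⟨⟨fun _ _ => by simp [zeroInputStrategy], fun _ _ => by simp [zeroInputStrategy]⟩,
    ⟨fun _ _ => rfl, fun _ _ => rfl⟩⟩

theorem zeroInputStrategy_cost (m : ℕ) (k : ℝ) (x₀ z : Vec m) :
    (zeroInputStrategy m).cost k x₀ z = 1 / (m : ℝ) * ‖z‖ ^ 2 := by
  simp [Strategy.cost, Strategy.x₂, Strategy.x₁, zeroInputStrategy]

theorem zeroInputStrategy_worstCost {m : ℕ} (hm : 0 < m) (k : ℝ) :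
    (zeroInputStrategy m).worstCost k = 3 := by
  have hm' : (0 : ℝ) < m := by exact_mod_cast hm
  have h3 : (3 : ENNReal) = ENNReal.ofReal 3 := by simp
  rw [h3]
  refine le_antisymm (Strategy.worstCost_le fun x₀ z hz => ENNReal.ofReal_le_ofReal ?_) ?_
  · rw [zeroInputStrategy_cost, one_div, inv_mul_le_iff₀ hm']
    simpa using norm_sq_le_mul (Real.sqrt_nonneg 3) fun i => (hz i).le
  -- The noise cube is open, so `3` is only approached, along the diagonal.
  · have htend : Tendsto (fun t : ℝ => ENNReal.ofReal (t ^ 2)) (𝓝[<] √3)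
        (𝓝 (ENNReal.ofReal (√3 ^ 2))) :=
      (ENNReal.continuous_ofReal.comp (continuous_pow 2)).continuousWithinAt
    rw [Real.sq_sqrt (by norm_num)] at htend
    refine le_of_tendsto htend ?_
    filter_upwards [Ioo_mem_nhdsLT (show (0 : ℝ) < √3 by positivity)] with t ht
    have := Strategy.ofReal_cost_le_worstCost k (zeroInputStrategy m) 0
      (z := WithLp.toLp 2 fun _ => t) (fun i => by simpa [abs_of_pos ht.1] using ht.2)
    rwa [zeroInputStrategy_cost, norm_sq_toLp_const, ← mul_assoc, one_div,
      inv_mul_cancel₀ hm'.ne', one_mul] at this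

theorem abs_quantize_sub_le {m : ℕ} (x : Vec m) (i : Fin m) :
    |(quantize x - x) i| ≤ √3 := by
  have hs : (0 : ℝ) < 2 * √3 := by positivity
  have h := abs_sub_round (x i / (2 * √3))
  have h1 : (quantize x - x) i
      = -(2 * √3 * (x i / (2 * √3) - (round (x i / (2 * √3)) : ℝ))) := by
    simp only [quantize, PiLp.sub_apply]
    field_simp
    ring
  rw [h1, abs_neg, abs_mul, abs_of_pos hs]
  nlinarith

/-- Noise stays strictly within half a bin, so decoding is exact and only the input cost remains. -/
theorem quantize_quantize_add {m : ℕ} (x : Vec m) {z : Vec m} (hz : ∀ i, |z i| < √3) :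
    quantize (quantize x + z) = quantize x := by
  ext i
  have hs : (0 : ℝ) < 2 * √3 := by positivity
  obtain ⟨h1, h2⟩ := abs_lt.1 (hz i)
  have h3 : round (z i / (2 * √3)) = 0 := by
    rw [round_eq_zero_iff]
    constructor
    · rw [le_div_iff₀ hs]; linarith
    · rw [div_lt_iff₀ hs]; linarith
  have h4 : (quantize x + z) i / (2 * √3)
      = (round (x i / (2 * √3)) : ℝ) + z i / (2 * √3) := by
    simp only [quantize, PiLp.add_apply]
    field_simp
  change 2 * √3 * (round ((quantize x + z) i / (2 * √3)) : ℝ)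
    = 2 * √3 * (round (x i / (2 * √3)) : ℝ)
  rw [h4, round_intCast_add, h3, add_zero]

theorem quantStrategy_cost {m : ℕ} (k : ℝ) (x₀ : Vec m) {z : Vec m} (hz : ∀ i, |z i| < √3) :
    (quantStrategy m).cost k x₀ z = 1 / (m : ℝ) * k ^ 2 * ‖quantize x₀ - x₀‖ ^ 2 := by
  simp [Strategy.cost, Strategy.x₂, Strategy.x₁, quantStrategy, quantize_quantize_add x₀ hz]

theorem quantStrategy_worstCost {m : ℕ} (hm : 0 < m) (k : ℝ) :
    (quantStrategy m).worstCost k = ENNReal.ofReal (3 * k ^ 2) := by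
  have hm' : (0 : ℝ) < m := by exact_mod_cast hm
  refine le_antisymm (Strategy.worstCost_le fun x₀ z hz => ENNReal.ofReal_le_ofReal ?_) ?_
  · rw [quantStrategy_cost k x₀ hz]
    have h := norm_sq_le_mul (Real.sqrt_nonneg 3) (abs_quantize_sub_le x₀)
    rw [Real.sq_sqrt (by norm_num)] at h
    calc 1 / (m : ℝ) * k ^ 2 * ‖quantize x₀ - x₀‖ ^ 2 ≤ 1 / (m : ℝ) * k ^ 2 * (m * 3) := by gcongr
      _ = 3 * k ^ 2 := by field_simp
  · have h0 : ∀ i, |(0 : Vec m) i| < √3 := by simp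
    -- A bin midpoint attains the supremum: `round` sends `1/2` up to `1`.
    have hq : quantize (WithLp.toLp 2 fun _ => √3 : Vec m) - (WithLp.toLp 2 fun _ => √3 : Vec m)
        = WithLp.toLp 2 fun _ => √3 := by
      ext i
      have : √3 / (2 * √3) = (2 : ℝ)⁻¹ := by field_simp
      simp only [quantize, PiLp.sub_apply, this, round_two_inv]
      push_cast
      ring
    refine le_trans (le_of_eq ?_)
      (Strategy.ofReal_cost_le_worstCost k (quantStrategy m) (WithLp.toLp 2 fun _ => √3) h0)
    rw [quantStrategy_cost k _ h0, hq, norm_sq_toLp_const, Real.sq_sqrt (by norm_num)]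
    congr 1
    field_simp

/-! ### Comparison and conclusion -/

theorem three_le_linCost {m : ℕ} (hm : 0 < m) {k : ℝ} (hk : k ≠ 0) : 3 ≤ linCost m k := by
  refine le_iInf₂ fun γ hγ => ?_
  by_cases htop : γ.worstCost k = ⊤
  · simp [htop]
  rw [hγ.eq_zeroInputStrategy hm hk htop, zeroInputStrategy_worstCost hm]

theorem tendsto_linCost_div_quantStrategy_worstCost {m : ℕ} (hm : 0 < m) :
    Tendsto (fun k : ℝ => linCost m k / (quantStrategy m).worstCost k) (𝓝[≠] 0) (𝓝 ⊤) := by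
  have hsq : Tendsto (fun k : ℝ => (k ^ 2)⁻¹) (𝓝[≠] 0) atTop := by
    refine tendsto_inv_nhdsGT_zero.comp (tendsto_nhdsWithin_iff.2 ⟨?_, ?_⟩)
    · simpa using (continuous_pow 2 (M := ℝ)).continuousWithinAt (s := {0}ᶜ) (x := 0) |>.tendsto
    · filter_upwards [self_mem_nhdsWithin] with k hk
      have : k ≠ 0 := hk
      exact Set.mem_Ioi.2 (by positivity)
  refine tendsto_nhds_top_mono (ENNReal.tendsto_ofReal_atTop.comp hsq) ?_
  filter_upwards [self_mem_nhdsWithin] with k hk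
  have hk0 : k ≠ 0 := hk
  calc ENNReal.ofReal (k ^ 2)⁻¹ = 3 / ENNReal.ofReal (3 * k ^ 2) := by
        rw [show (3 : ENNReal) = ENNReal.ofReal 3 by simp,
          ← ENNReal.ofReal_div_of_pos (by positivity)]
        congr 1
        field_simp
    _ ≤ _ := by
        rw [quantStrategy_worstCost hm]
        exact ENNReal.div_le_div_right (three_le_linCost hm hk0) _

theorem optCost_le {m : ℕ} (hm : 0 < m) (k : ℝ) :
    optCost m k ≤ ENNReal.ofReal (2 * Real.pi * Real.exp 1 * lowerCost k) := by
  refine le_trans ?_ (ENNReal.ofReal_le_ofReal (min_le_mul_lowerCost k))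
  rcases min_choice (3 * k ^ 2) 3 with h | h <;> rw [h]
  · exact (iInf_le _ (quantStrategy m)).trans (quantStrategy_worstCost hm k).le
  · refine (iInf_le _ (zeroInputStrategy m)).trans ?_
    rw [zeroInputStrategy_worstCost hm]
    simp

theorem theorem4 (m : ℕ) (hm : 0 < m) :
    (∀ k : ℝ,
      -- the optimal cost lies between the lower bound and a constant multiple of it
      ENNReal.ofReal (lowerCost k) ≤ optCost m k ∧
      optCost m k ≤ ENNReal.ofReal (2 * Real.pi * Real.exp 1 * lowerCost k) ∧
      -- the upper bound is achieved by quantization, complemented by a linear strategy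
      (quantStrategy m).worstCost k = ENNReal.ofReal (3 * k ^ 2) ∧
      (zeroInputStrategy m).IsLinear ∧
      (zeroInputStrategy m).worstCost k = 3 ∧
      min (3 * k ^ 2) 3 ≤ 2 * Real.pi * Real.exp 1 * lowerCost k) ∧
    -- the best linear strategy is worse than quantization by an unbounded factor
    Tendsto (fun k : ℝ => linCost m k / (quantStrategy m).worstCost k) (𝓝[≠] 0) (𝓝 ⊤) := by
  exact ⟨fun k => ⟨le_iInf (Strategy.ofReal_lowerCost_le_worstCost hm k), optCost_le hm k,
    quantStrategy_worstCost hm k, zeroInputStrategy_isLinear m, zeroInputStrategy_worstCost hm k,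
    min_le_mul_lowerCost k⟩, tendsto_linCost_div_quantStrategy_worstCost hm⟩
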